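/- Let $S$ be a left reversible and separable semitopological semigroup: a semigroup with a separable Hausdorff topology in which $s\mapsto ts$ and $s\mapsto st$ are continuous for every $t\in S$, such that $\overline{sS}\cap\overline{tS}\neq\emptyset$ for all $s,t\in S$. Let $C$ be a weakly closed subset of a complex Hilbert space $H$, and let $\mathcal S=\{T_s : s\in S\}$ be a representation of $S$ on $C$, that is, $T_s\colon C\to C$ and $T_{st}x=T_s(T_tx)$ for all $s,t\in S$, $x\in C$. Suppose that $\|T_sx-T_sy\|\le\|x-y\|$ for all $s\in S$ and $x,y\in C$, and that $(s,x)\mapsto T_sx$ is continuous from $S\times(C,\mathrm{wk})$ to $(C,\mathrm{wk})$, where $\mathrm{wk}$ is the weak topology of $H$. If there is $c\in C$ such that $\{T_sc : s\in S\}$ is bounded, then the set of attractive points $$A_C(\mathcal S)=\{a\in H : \|a-T_sx\|\le\|a-x\| \text{ for all } s\in S,\ x\in C\}$$ is nonempty. In particular, if in addition $C$ is convex, then $S$ has a common fixed point in $C$, that is, the set $F(\mathcal S)=\{x\in C : T_sx=x\text{ for all }s\in S\}$ is nonempty. -/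

import Mathlib

open Set Topology

/-- Left reversibility of a semigroup with a topology: any two of the closed right ideals
`closure (s S)` and `closure (t S)` intersect. -/
def LeftReversible (S : Type*) [Semigroup S] [TopologicalSpace S] : Prop :=
  ∀ s t : S, (closure (range fun r : S => s * r) ∩ closure (range fun r : S => t * r)).Nonempty

section Representation

variable {S H : Type*} [NormedAddCommGroup H] [InnerProductSpace ℂ H] {C : Set H}

/-- A set is weakly closed if it is closed in the weak topology of `H`. -/
def IsWeaklyClosed (C : Set H) : Prop :=
  IsClosed (toWeakSpace ℂ H '' C)

/-- The topology that the weak topology of `H` induces on a subset `C`. -/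
noncomputable abbrev weakTopologyOn (C : Set H) : TopologicalSpace C :=
  TopologicalSpace.induced (fun x : C => toWeakSpace ℂ H (x : H)) inferInstance

/-- `s ↦ T s` is a representation of the semigroup `S` by self-maps of `C`. -/
def IsRepresentation [Semigroup S] (T : S → C → C) : Prop :=
  ∀ (s t : S) (x : C), T (s * t) x = T s (T t x)

/-- Every `T s` is nonexpansive for the norm. -/
def IsNonexpansiveRep (T : S → C → C) : Prop :=
  ∀ (s : S) (x y : C), ‖(T s x : H) - (T s y : H)‖ ≤ ‖(x : H) - (y : H)‖

/-- `(s, x) ↦ T s x` is continuous from `S × C` to `C`, where `C` carries the weak topology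
both times. -/
def IsWeaklyJointlyContinuous [τ : TopologicalSpace S] (T : S → C → C) : Prop :=
  @Continuous (S × C) C (@instTopologicalSpaceProd S C τ (weakTopologyOn C)) (weakTopologyOn C)
    fun p => T p.1 p.2

/-- The set of attractive points in `H` of the family `T` on `C`. -/
def attractivePoints (T : S → C → C) : Set H :=
  {a | ∀ (s : S) (x : C), ‖a - (T s x : H)‖ ≤ ‖a - (x : H)‖}

/-- The set of common fixed points in `C` of the family `T`. -/
def commonFixedPoints (T : S → C → C) : Set C :=
  {x | ∀ s : S, T s x = x}

end Representation

open Filter Metric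

/-! ### Compact sets covered by their own images -/

section BackwardInvariance

variable {X : Type*} [TopologicalSpace X] [T2Space X]

/-! The weak closure `K` of a bounded orbit is weakly compact and invariant. Left reversibility
makes the sets `T s '' K` directed, so their intersection is nonempty, and each `T s` maps it onto a
superset of itself. Zorn's lemma gives a minimal compact `Q` with this property.

Minimality forces `Q` to be totally bounded in norm (`totallyBounded_image_of_minimal`). Average
uniformly over a `δ`-separated subset of `Q` of maximal cardinality: preimages of its points in `Q`
are again separated, and Hall's theorem matches them with the original points up to `δ`, so the
average is attractive up to an error that vanishes with `δ` (`exists_almost_attractive`). Norm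
compactness of the closed convex hull yields a limit, which is attractive. If `C` is convex, the
point of `C` nearest to it is fixed. -/

theorem exists_mem_iInter_apply_eq_of_directed {ι : Type*} [Nonempty ι] {f : X → X}
    (hf : Continuous f) {K : ι → Set X} (hd : Directed (· ⊇ ·) K) (hK : ∀ i, IsCompact (K i))
    {y : X} (hy : ∀ i, y ∈ f '' K i) : ∃ x ∈ ⋂ i, K i, f x = y := by
  have hcl : IsClosed (f ⁻¹' {y}) := isClosed_singleton.preimage hf
  obtain ⟨x, hx⟩ := IsCompact.nonempty_iInter_of_directed_nonempty_isCompact_isClosed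
    (fun i => K i ∩ f ⁻¹' {y})
    (fun i j => (hd i j).imp fun k hk =>
      ⟨inter_subset_inter_left _ hk.1, inter_subset_inter_left _ hk.2⟩)
    (fun i => (hy i).imp fun x hx => hx)
    (fun i => (hK i).inter_right hcl)
    (fun i => (hK i).isClosed.inter hcl)
  rw [mem_iInter] at hx
  exact ⟨x, mem_iInter.2 fun i => (hx i).1, (hx (Classical.arbitrary ι)).2⟩

/-- A left reversible semigroup acting on a compact set `K` has a nonempty compact subset of `K`
that each element of the semigroup maps onto a superset. -/
theorem LeftReversible.exists_isCompact_subset_image {S : Type*} [Semigroup S]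
    [TopologicalSpace S] [Nonempty S] (hS : LeftReversible S) {T : S → X → X}
    (hmul : ∀ s t x, T (s * t) x = T s (T t x)) (hT : ∀ s, Continuous (T s))
    (hT' : ∀ x, Continuous fun s => T s x) {K : Set X} (hK : IsCompact K) (hne : K.Nonempty)
    (hmaps : ∀ s, MapsTo (T s) K K) :
    ∃ F ⊆ K, F.Nonempty ∧ IsCompact F ∧ ∀ s, F ⊆ T s '' F := by
  have hcpt : ∀ s, IsCompact (T s '' K) := fun s => hK.image (hT s)
  have hsub : ∀ s u, u ∈ closure (range fun r : S => s * r) → T u '' K ⊆ T s '' K := by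
    rintro s u hu _ ⟨x, hx, rfl⟩
    have h : T u x ∈ closure ((fun v => T v x) '' range fun r : S => s * r) :=
      image_closure_subset_closure_image (hT' x) ⟨u, hu, rfl⟩
    refine (hcpt s).isClosed.closure_subset_iff.2 ?_ h
    rintro _ ⟨_, ⟨r, rfl⟩, rfl⟩
    exact ⟨T r x, hmaps r hx, (hmul s r x).symm⟩
  have hd : Directed (· ⊇ ·) fun s => T s '' K := fun s t =>
    (hS s t).imp fun u hu => ⟨hsub s u hu.1, hsub t u hu.2⟩
  have s₀ : S := Classical.arbitrary S
  have hcl : IsClosed (⋂ s, T s '' K) := isClosed_iInter fun s => (hcpt s).isClosed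
  have hFK : ⋂ s, T s '' K ⊆ K := (iInter_subset _ s₀).trans (hmaps s₀).image_subset
  refine ⟨⋂ s, T s '' K, hFK, ?_, hK.of_isClosed_subset hcl hFK, fun t y hy => ?_⟩
  · exact IsCompact.nonempty_iInter_of_directed_nonempty_isCompact_isClosed _ hd
      (fun s => hne.image _) hcpt fun s => (hcpt s).isClosed
  -- A point of `T (t * s) '' K` has a `T t`-preimage in `T s '' K`; compactness of the fibre gives
  -- one preimage for all `s`.
  · refine exists_mem_iInter_apply_eq_of_directed (hT t) hd hcpt fun s => ?_
    obtain ⟨x, hx, rfl⟩ := mem_iInter.1 hy (t * s)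
    exact ⟨T s x, ⟨x, hx, rfl⟩, (hmul t s x).symm⟩

theorem exists_minimal_isCompact_subset_image {S : Type*} {T : S → X → X}
    (hT : ∀ s, Continuous (T s)) {F : Set X} (hne : F.Nonempty) (hF : IsCompact F)
    (hFT : ∀ s, F ⊆ T s '' F) :
    ∃ Q ⊆ F, Minimal (fun Q : Set X => Q.Nonempty ∧ IsCompact Q ∧ ∀ s, Q ⊆ T s '' Q) Q := by
  refine zorn_superset_nonempty {Q : Set X | Q.Nonempty ∧ IsCompact Q ∧ ∀ s, Q ⊆ T s '' Q}
    (fun c hc hchain hcne => ?_) F ⟨hne, hF, hFT⟩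
  have : Nonempty c := hcne.to_subtype
  have hd : Directed (· ⊇ ·) fun Q : c => (Q : Set X) := fun A B =>
    (hchain.total A.2 B.2).elim (fun h => ⟨A, subset_rfl, h⟩) fun h => ⟨B, h, subset_rfl⟩
  have hcpt : ∀ Q : c, IsCompact (Q : Set X) := fun Q => (hc Q.2).2.1
  refine ⟨⋂ Q : c, (Q : Set X), ⟨?_, ?_, fun s y hy => ?_⟩,
    fun Q hQ => iInter_subset (fun Q : c => (Q : Set X)) ⟨Q, hQ⟩⟩
  · exact IsCompact.nonempty_iInter_of_directed_nonempty_isCompact_isClosed _ hd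
      (fun Q => (hc Q.2).1) hcpt fun Q => (hcpt Q).isClosed
  · exact (hcpt (Classical.arbitrary c)).of_isClosed_subset
      (isClosed_iInter fun Q => (hcpt Q).isClosed) (iInter_subset _ _)
  · exact exists_mem_iInter_apply_eq_of_directed (hT s) hd hcpt fun Q =>
      (hc Q.2).2.2 s (mem_iInter.1 hy Q)

end BackwardInvariance

/-! ### Norm total boundedness from minimality -/

section TotallyBounded

variable {X H : Type*} [NormedAddCommGroup H]

/-- `B` is covered by finitely many balls of radius `δ` for the distance induced by `E`. -/
def FinitelyCovered (E : X → H) (δ : ℝ) (B : Set X) : Prop :=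
  ∃ t : Set X, t.Finite ∧ ∀ x ∈ B, ∃ z ∈ t, ‖E x - E z‖ ≤ δ

namespace FinitelyCovered

variable {E : X → H} {δ : ℝ} {A B : Set X}

theorem empty : FinitelyCovered E δ ∅ := ⟨∅, finite_empty, by simp⟩

theorem mono (hB : FinitelyCovered E δ B) (h : A ⊆ B) : FinitelyCovered E δ A :=
  hB.imp fun _ ht => ⟨ht.1, fun x hx => ht.2 x (h hx)⟩

theorem union (hA : FinitelyCovered E δ A) (hB : FinitelyCovered E δ B) :
    FinitelyCovered E δ (A ∪ B) := by
  obtain ⟨t, ht, htA⟩ := hA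
  obtain ⟨u, hu, huB⟩ := hB
  refine ⟨t ∪ u, ht.union hu, fun x hx => hx.elim (fun h => ?_) fun h => ?_⟩
  · exact (htA x h).imp fun z hz => ⟨Or.inl hz.1, hz.2⟩
  · exact (huB x h).imp fun z hz => ⟨Or.inr hz.1, hz.2⟩

theorem image (hA : FinitelyCovered E δ A) {f : X → X}
    (hf : ∀ x y, ‖E (f x) - E (f y)‖ ≤ ‖E x - E y‖) : FinitelyCovered E δ (f '' A) := by
  obtain ⟨t, ht, htA⟩ := hA
  refine ⟨f '' t, ht.image f, ?_⟩
  rintro _ ⟨x, hx, rfl⟩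
  obtain ⟨z, hz, hxz⟩ := htA x hx
  exact ⟨f z, ⟨z, hz, rfl⟩, (hf x z).trans hxz⟩

end FinitelyCovered

/-- The filter of sets whose complement in `Q` is covered by finitely many balls of
radius `δ`. -/
def cofinitelyCovered (E : X → H) (δ : ℝ) (Q : Set X) : Filter X where
  sets := {B | FinitelyCovered E δ (Q \ B)}
  univ_sets := by simpa using FinitelyCovered.empty
  sets_of_superset hA h := FinitelyCovered.mono hA (sdiff_subset_sdiff_right h)
  inter_sets hA hB := by
    rw [mem_ofPred_eq, sdiff_inter]
    exact FinitelyCovered.union hA hB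

variable {E : X → H} {δ : ℝ} {Q : Set X}

theorem mem_cofinitelyCovered {B : Set X} :
    B ∈ cofinitelyCovered E δ Q ↔ FinitelyCovered E δ (Q \ B) := Iff.rfl

theorem self_mem_cofinitelyCovered : Q ∈ cofinitelyCovered E δ Q := by
  simpa [mem_cofinitelyCovered] using FinitelyCovered.empty

theorem cofinitelyCovered_le_map {f : X → X} (hf : ∀ x y, ‖E (f x) - E (f y)‖ ≤ ‖E x - E y‖)
    (hQ : Q ⊆ f '' Q) : cofinitelyCovered E δ Q ≤ map f (cofinitelyCovered E δ Q) := by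
  intro D hD
  refine FinitelyCovered.mono (FinitelyCovered.image (mem_cofinitelyCovered.1 hD) hf) ?_
  rintro y ⟨hy, hyD⟩
  obtain ⟨x, hx, rfl⟩ := hQ hy
  exact ⟨x, ⟨hx, hyD⟩, rfl⟩

/-- A nonempty bounded set has a point whose weak neighbourhoods in the set can be arbitrarily
small for the norm. -/
theorem exists_not_clusterPt_cofinitelyCovered [InnerProductSpace ℝ H] [TopologicalSpace X]
    (hE : ∀ h, Continuous fun x => inner ℝ h (E x)) (hδ : 0 < δ) (hQ : Q.Nonempty)
    (hb : Bornology.IsBounded (E '' Q)) :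
    ∃ u ∈ Q, ¬ ClusterPt u (cofinitelyCovered E δ Q) := by
  obtain ⟨R, hR⟩ := hb.exists_norm_le
  set A : Set ℝ := (fun x => ‖E x‖ ^ 2) '' Q
  have hA : BddAbove A := by
    refine ⟨R ^ 2, ?_⟩
    rintro _ ⟨x, hx, rfl⟩
    have := hR _ ⟨x, hx, rfl⟩
    simp only
    gcongr
  -- With `u` this close to the supremum, expanding `‖E x - E u‖ ^ 2` on the weak neighbourhood
  -- below loses `δ ^ 2 / 3` once from `u` and twice from the inner product, in all `δ ^ 2`.
  obtain ⟨_, ⟨u, hu, rfl⟩, hlt⟩ := exists_lt_of_lt_csSup (hQ.image _)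
    (show sSup A - δ ^ 2 / 3 < sSup A by nlinarith [pow_pos hδ 2])
  refine ⟨u, hu, fun hcl => ?_⟩
  have hV : {x | ‖E u‖ ^ 2 - δ ^ 2 / 3 < inner ℝ (E u) (E x)} ∈ 𝓝 u := by
    refine (isOpen_lt continuous_const (hE (E u))).mem_nhds ?_
    simp only [mem_ofPred_eq, real_inner_self_eq_norm_sq]
    nlinarith [pow_pos hδ 2]
  have hW : {x | ‖E u‖ ^ 2 - δ ^ 2 / 3 < inner ℝ (E u) (E x)}ᶜ ∈ cofinitelyCovered E δ Q := by
    refine ⟨{u}, finite_singleton u, fun x hx => ⟨u, rfl, ?_⟩⟩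
    have hx1 : ‖E u‖ ^ 2 - δ ^ 2 / 3 < inner ℝ (E u) (E x) := not_not.1 hx.2
    have hx2 : ‖E x‖ ^ 2 ≤ sSup A := le_csSup hA ⟨x, hx.1, rfl⟩
    refine le_of_sq_le_sq ?_ hδ.le
    rw [norm_sub_sq_real, real_inner_comm]
    simp only at hlt
    linarith
  rw [clusterPt_iff_nonempty] at hcl
  obtain ⟨x, hx, hx'⟩ := hcl hV hW
  exact hx' hx

/-- If some radius admitted no finite cover, the filter `cofinitelyCovered` would be proper. Its
cluster points in `Q` form a nonempty compact set covered by its images, hence all of `Q` by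
minimality, against `exists_not_clusterPt_cofinitelyCovered`. -/
theorem totallyBounded_image_of_minimal [InnerProductSpace ℝ H] [TopologicalSpace X] [T2Space X]
    (hE : ∀ h, Continuous fun x => inner ℝ h (E x)) {S : Type*} {T : S → X → X}
    (hT : ∀ s, Continuous (T s)) (hne : ∀ s x y, ‖E (T s x) - E (T s y)‖ ≤ ‖E x - E y‖)
    (hQ : Minimal (fun Q : Set X => Q.Nonempty ∧ IsCompact Q ∧ ∀ s, Q ⊆ T s '' Q) Q)
    (hb : Bornology.IsBounded (E '' Q)) : TotallyBounded (E '' Q) := by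
  obtain ⟨hQne, hQc, hQT⟩ := hQ.prop
  refine Metric.totallyBounded_iff.2 fun ε hε => ?_
  suffices h : cofinitelyCovered E (ε / 2) Q = ⊥ by
    have h0 : ∅ ∈ cofinitelyCovered E (ε / 2) Q := h ▸ mem_bot
    obtain ⟨t, ht, htQ⟩ := mem_cofinitelyCovered.1 h0
    refine ⟨E '' t, ht.image E, ?_⟩
    rintro _ ⟨x, hx, rfl⟩
    obtain ⟨z, hz, hxz⟩ := htQ x ⟨hx, notMem_empty x⟩
    refine mem_iUnion₂.2 ⟨E z, ⟨z, hz, rfl⟩, ?_⟩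
    rw [mem_ball, dist_eq_norm]
    linarith
  set 𝓕 := cofinitelyCovered E (ε / 2) Q
  by_contra h𝓕
  have : NeBot 𝓕 := ⟨h𝓕⟩
  have hle : 𝓕 ≤ 𝓟 Q := le_principal_iff.2 self_mem_cofinitelyCovered
  have hsub : {x | ClusterPt x 𝓕} ⊆ Q := fun x hx =>
    hQc.isClosed.closure_subset (mem_closure_iff_clusterPt.2 (hx.mono hle))
  obtain ⟨u, hu, hu'⟩ := exists_not_clusterPt_cofinitelyCovered hE (half_pos hε) hQne hb
  refine hu' (hQ.le_of_le ⟨?_, ?_, fun s y hy => ?_⟩ hsub hu)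
  · obtain ⟨x, -, hx⟩ := hQc hle
    exact ⟨x, hx⟩
  · exact hQc.of_isClosed_subset isClosed_setOfPred_clusterPt hsub
  -- A cluster point `x` of `𝓕` along the preimages of neighbourhoods of `y` satisfies `T s x = y`,
  -- the space being Hausdorff.
  · have hmap : NeBot (map (T s) (𝓕 ⊓ comap (T s) (𝓝 y))) := by
      rw [Filter.push_pull, inf_comm]
      exact ClusterPt.mono hy (cofinitelyCovered_le_map (hne s) (hQT s))
    have hG : NeBot (𝓕 ⊓ comap (T s) (𝓝 y)) := hmap.of_map
    obtain ⟨x, -, hx⟩ := hQc (inf_le_left.trans hle : 𝓕 ⊓ comap (T s) (𝓝 y) ≤ 𝓟 Q)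
    refine ⟨x, hx.mono inf_le_left, ?_⟩
    have h1 : ClusterPt (T s x) (𝓝 y) :=
      ((hx.mono inf_le_right).map (hT s).continuousAt tendsto_map).mono map_comap_le
    exact eq_of_nhds_neBot h1

end TotallyBounded

/-! ### Averages over maximal separated sets -/

section Averages

variable {X H : Type*} [NormedAddCommGroup H]

theorem TotallyBounded.exists_finset_card_max {A : Set H} (hA : TotallyBounded A) {δ : ℝ}
    (hδ : 0 < δ) :
    ∃ F : Finset H, ↑F ⊆ A ∧ (F : Set H).Pairwise (fun x y => δ < ‖x - y‖) ∧
      ∀ G : Finset H, ↑G ⊆ A → (G : Set H).Pairwise (fun x y => δ < ‖x - y‖) →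
        G.card ≤ F.card := by
  classical
  obtain ⟨t, ht, hAt⟩ := Metric.totallyBounded_iff.1 hA (δ / 2) (half_pos hδ)
  have hbound : ∀ G : Finset H, ↑G ⊆ A → (G : Set H).Pairwise (fun x y => δ < ‖x - y‖) →
      G.card ≤ ht.toFinset.card := by
    intro G hG hsep
    have hc : ∀ x ∈ G, ∃ z ∈ t, x ∈ ball z (δ / 2) := fun x hx => by
      simpa using hAt (hG hx)
    choose! c hct hc using hc
    refine Finset.card_le_card_of_injOn c (fun x hx => by simpa using hct x hx) ?_
    intro x hx y hy hxy
    by_contra hne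
    have h1 : δ < ‖x - y‖ := hsep hx hy hne
    have h2 := hc x hx
    have h3 := hc y hy
    rw [hxy] at h2
    rw [mem_ball] at h2 h3
    rw [← dist_eq_norm] at h1
    linarith [dist_triangle_right x y (c y)]
  let P : ℕ → Prop := fun n => ∃ F : Finset H, ↑F ⊆ A ∧
    (F : Set H).Pairwise (fun x y => δ < ‖x - y‖) ∧ F.card = n
  obtain ⟨F, hFA, hF, hcard⟩ : P (Nat.findGreatest P ht.toFinset.card) :=
    Nat.findGreatest_spec (Nat.zero_le _) ⟨∅, by simp, by simp, rfl⟩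
  refine ⟨F, hFA, hF, fun G hG hsep => ?_⟩
  rw [hcard]
  exact Nat.le_findGreatest (hbound G hG hsep) ⟨G, hG, hsep, rfl⟩

/-- By Hall's theorem, a separated family can be matched with a separated set of maximal
cardinality, if the family is indexed by that set. -/
theorem exists_bijective_norm_sub_le_of_card_max {A : Set H} {δ : ℝ} (hδ : 0 ≤ δ)
    {F : Finset H} (hFA : ↑F ⊆ A) (hF : (F : Set H).Pairwise (fun x y => δ < ‖x - y‖))
    (hmax : ∀ G : Finset H, ↑G ⊆ A → (G : Set H).Pairwise (fun x y => δ < ‖x - y‖) →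
      G.card ≤ F.card)
    {y : F → H} (hyA : ∀ a, y a ∈ A) (hyinj : Function.Injective y)
    (hy : Pairwise fun a b => δ < ‖y a - y b‖) :
    ∃ f : F → F, Function.Bijective f ∧ ∀ a, ‖y a - f a‖ ≤ δ := by
  classical
  suffices h : ∀ B : Finset F, B.card ≤
      (Finset.univ.filter fun b : F => ∃ a ∈ B, ‖y a - b‖ ≤ δ).card by
    obtain ⟨f, hf, hfy⟩ := (Fintype.all_card_le_filter_rel_iff_exists_injective
      fun a b : F => ‖y a - b‖ ≤ δ).1 h
    exact ⟨f, Finite.injective_iff_bijective.1 hf, hfy⟩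
  intro B
  set N : Finset F := {b | ∃ a ∈ B, ‖y a - b‖ ≤ δ}
  have hfar : ∀ a ∈ B, ∀ b ∈ Nᶜ, δ < ‖y a - b‖ := fun a ha b hb => by
    by_contra! h
    exact Finset.mem_compl.1 hb (Finset.mem_filter.2 ⟨Finset.mem_univ b, a, ha, h⟩)
  have hdisj : Disjoint (B.image y) (Nᶜ.image Subtype.val) := by
    rw [Finset.disjoint_left]
    intro z hz hz'
    obtain ⟨a, ha, rfl⟩ := Finset.mem_image.1 hz
    obtain ⟨b, hb, hab⟩ := Finset.mem_image.1 hz'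
    have := hfar a ha b hb
    rw [hab, sub_self, norm_zero] at this
    linarith
  -- `y '' B` and the complement of `N` form one separated set; maximality of `F` then gives Hall's
  -- condition `B.card ≤ N.card`.
  have hcard := hmax (B.image y ∪ Nᶜ.image Subtype.val) ?_ ?_
  · rw [Finset.card_union_of_disjoint hdisj, Finset.card_image_of_injective _ hyinj,
      Finset.card_image_of_injective _ Subtype.val_injective, Finset.card_compl,
      Fintype.card_coe] at hcard
    have := Finset.card_le_univ N
    rw [Fintype.card_coe] at this
    omega
  · intro z hz
    rcases Finset.mem_union.1 (Finset.mem_coe.1 hz) with hz | hz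
    · obtain ⟨a, -, rfl⟩ := Finset.mem_image.1 hz
      exact hyA a
    · obtain ⟨b, -, rfl⟩ := Finset.mem_image.1 hz
      exact hFA b.2
  · intro z hz w hw hzw
    rcases Finset.mem_union.1 (Finset.mem_coe.1 hz) with hz | hz <;>
    rcases Finset.mem_union.1 (Finset.mem_coe.1 hw) with hw | hw <;>
    obtain ⟨a, ha, rfl⟩ := Finset.mem_image.1 hz <;>
    obtain ⟨b, hb, rfl⟩ := Finset.mem_image.1 hw
    · exact hy fun h => hzw (congrArg y h)
    · exact hfar a ha b hb
    · rw [norm_sub_rev]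
      exact hfar b hb a ha
    · exact hF a.2 b.2 hzw

/-- The spread of `F` about its barycentre does not depend on `y` or `z`, so it cancels. -/
theorem sum_norm_sub_sq_sub_sum_norm_sub_sq [InnerProductSpace ℝ H] (F : Finset H)
    (hF : F.Nonempty) (y z : H) :
    ∑ x ∈ F, ‖y - x‖ ^ 2 - ∑ x ∈ F, ‖z - x‖ ^ 2 =
      F.card * (‖y - F.centerMass (fun _ => (1 : ℝ)) id‖ ^ 2 -
        ‖z - F.centerMass (fun _ => (1 : ℝ)) id‖ ^ 2) := by
  have hc : (F.card : ℝ) ≠ 0 := by exact_mod_cast hF.card_ne_zero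
  simp only [norm_sub_sq_real, Finset.centerMass, Finset.sum_const, nsmul_eq_mul, mul_one,
    one_smul, id, inner_smul_right, Finset.sum_add_distrib, Finset.sum_sub_distrib,
    ← Finset.mul_sum, inner_sum]
  field_simp
  ring

/-- A uniform average over a totally bounded set `A` is almost attractive for all nonexpansive maps
that send `A` onto a superset of `A`. -/
theorem exists_almost_attractive [InnerProductSpace ℝ H] {E : X → H} {Q : Set X}
    (hQ : Q.Nonempty) (hA : TotallyBounded (E '' Q)) {R : ℝ} (hR : ∀ x ∈ Q, ‖E x‖ ≤ R)
    {δ : ℝ} (hδ : 0 < δ) :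
    ∃ a ∈ convexHull ℝ (E '' Q), ∀ f : X → X, Q ⊆ f '' Q →
      (∀ x y, ‖E (f x) - E (f y)‖ ≤ ‖E x - E y‖) →
      ∀ w, ‖E (f w) - a‖ ^ 2 ≤ ‖E w - a‖ ^ 2 + δ * (2 * (‖E w‖ + R) + δ) := by
  obtain ⟨F, hFA, hF, hmax⟩ := hA.exists_finset_card_max hδ
  have hFne : F.Nonempty := by
    obtain ⟨q, hq⟩ := hQ
    have := hmax {E q} (by simpa using ⟨q, hq, rfl⟩) (by simp)
    exact Finset.card_pos.1 (by simpa using this)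
  have hcpos : (0 : ℝ) < F.card := by exact_mod_cast hFne.card_pos
  refine ⟨F.centerMass (fun _ => (1 : ℝ)) id,
    F.centerMass_mem_convexHull (fun _ _ => zero_le_one) (by simpa using hFne.card_pos)
      fun x hx => hFA hx, fun f hfQ hf w => ?_⟩
  have hpre : ∀ a : F, ∃ z ∈ Q, E (f z) = a := fun a => by
    obtain ⟨q, hq, hqa⟩ := hFA a.2
    obtain ⟨z, hz, rfl⟩ := hfQ hq
    exact ⟨z, hz, hqa⟩
  choose z hzQ hz using hpre
  have hexp : ∀ a b : F, ‖(a : H) - b‖ ≤ ‖E (z a) - E (z b)‖ := fun a b => by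
    simpa [hz] using hf (z a) (z b)
  have hsep : Pairwise fun a b : F => δ < ‖E (z a) - E (z b)‖ := fun a b hab =>
    (hF a.2 b.2 (Subtype.coe_injective.ne hab)).trans_le (hexp a b)
  have hinj : Function.Injective fun a : F => E (z a) := fun a b hab => by
    by_contra hne
    have h : δ < ‖E (z a) - E (z b)‖ := hsep hne
    simp only at hab
    rw [hab, sub_self, norm_zero] at h
    exact h.not_gt hδ
  obtain ⟨g, hg, hgz⟩ := exists_bijective_norm_sub_le_of_card_max hδ.le hFA hF hmax
    (y := fun a => E (z a)) (fun a => ⟨z a, hzQ a, rfl⟩) hinj hsep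
  have hterm : ∀ a : F, ‖E (f w) - a‖ ^ 2 ≤
      ‖E w - g a‖ ^ 2 + δ * (2 * (‖E w‖ + R) + δ) := fun a => by
    have h1 : ‖E (f w) - a‖ ≤ ‖E w - E (z a)‖ := by simpa [hz] using hf w (z a)
    have h2 : ‖E w - E (z a)‖ ≤ ‖E w - g a‖ + δ := by
      have h := norm_sub_le_norm_sub_add_norm_sub (E w) (g a : H) (E (z a))
      rw [norm_sub_rev (g a : H)] at h
      linarith [hgz a]
    have h3 : ‖E w - g a‖ ≤ ‖E w‖ + R := by
      obtain ⟨q, hq, hqa⟩ := hFA (g a).2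
      have h := norm_sub_le (E w) (g a : H)
      rw [← hqa] at h ⊢
      linarith [hR q hq]
    calc ‖E (f w) - a‖ ^ 2 ≤ (‖E w - g a‖ + δ) ^ 2 := by
          gcongr
          exact h1.trans h2
      _ = ‖E w - g a‖ ^ 2 + δ * (2 * ‖E w - g a‖ + δ) := by ring
      _ ≤ _ := by gcongr
  have hsum : ∑ x ∈ F, ‖E (f w) - x‖ ^ 2 ≤
      ∑ x ∈ F, ‖E w - x‖ ^ 2 + F.card * (δ * (2 * (‖E w‖ + R) + δ)) := by
    rw [← Finset.sum_coe_sort F, ← Finset.sum_coe_sort F fun x => ‖E w - x‖ ^ 2,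
      ← hg.sum_comp fun x : F => ‖E w - x‖ ^ 2]
    refine (Finset.sum_le_sum fun a _ => hterm a).trans_eq ?_
    simp [Finset.sum_add_distrib]
  have hid := sum_norm_sub_sq_sub_sum_norm_sub_sq F hFne (E (f w)) (E w)
  have : F.card * (‖E (f w) - F.centerMass (fun _ => (1 : ℝ)) id‖ ^ 2 -
      ‖E w - F.centerMass (fun _ => (1 : ℝ)) id‖ ^ 2) ≤
      F.card * (δ * (2 * (‖E w‖ + R) + δ)) := by linarith
  linarith [le_of_mul_le_mul_left this hcpos]

theorem exists_attractive [InnerProductSpace ℝ H] [CompleteSpace H] {E : X → H} {Q : Set X}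
    (hQ : Q.Nonempty) (hA : TotallyBounded (E '' Q)) :
    ∃ a, ∀ f : X → X, Q ⊆ f '' Q → (∀ x y, ‖E (f x) - E (f y)‖ ≤ ‖E x - E y‖) →
      ∀ w, ‖a - E (f w)‖ ≤ ‖a - E w‖ := by
  obtain ⟨R, hR⟩ := hA.isBounded.exists_norm_le
  have hpos : ∀ n : ℕ, (0 : ℝ) < 1 / ((n : ℝ) + 1) := fun n => Nat.one_div_pos_of_nat
  choose a ha hatt using fun n : ℕ =>
    exists_almost_attractive hQ hA (fun x hx => hR _ ⟨x, hx, rfl⟩) (hpos n)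
  have hcpt : IsCompact (closure (convexHull ℝ (E '' Q))) :=
    (totallyBounded_convexHull.2 hA).closure.isCompact_of_isClosed isClosed_closure
  obtain ⟨b, -, φ, hφ, hlim⟩ := hcpt.tendsto_subseq fun n => subset_closure (ha n)
  refine ⟨b, fun f hfQ hf w => ?_⟩
  have hδ : Tendsto (fun n => 1 / ((φ n : ℝ) + 1)) atTop (𝓝 0) :=
    tendsto_one_div_add_atTop_nhds_zero_nat.comp hφ.tendsto_atTop
  have h1 : Tendsto (fun n => ‖E (f w) - a (φ n)‖ ^ 2) atTop (𝓝 (‖E (f w) - b‖ ^ 2)) :=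
    ((tendsto_const_nhds.sub hlim).norm).pow 2
  have h2 : Tendsto (fun n => ‖E w - a (φ n)‖ ^ 2 +
      1 / ((φ n : ℝ) + 1) * (2 * (‖E w‖ + R) + 1 / ((φ n : ℝ) + 1))) atTop
      (𝓝 (‖E w - b‖ ^ 2 + 0 * (2 * (‖E w‖ + R) + 0))) :=
    (((tendsto_const_nhds.sub hlim).norm).pow 2).add (hδ.mul (tendsto_const_nhds.add hδ))
  have h3 := le_of_tendsto_of_tendsto' h1 h2 fun n => hatt (φ n) f hfQ hf w
  rw [zero_mul, add_zero] at h3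
  rw [norm_sub_rev b, norm_sub_rev b]
  exact le_of_sq_le_sq h3 (norm_nonneg _)

end Averages

/-! ### Weak compactness and nearest points -/

section WeakCompactness

variable {H : Type*} [NormedAddCommGroup H] [InnerProductSpace ℂ H] [CompleteSpace H]

theorem surjective_inclusionInDoubleDualWeak :
    Function.Surjective (NormedSpace.inclusionInDoubleDualWeak ℂ H) := by
  intro φ
  let ψ : StrongDual ℂ (StrongDual ℂ H) := WeakDual.toStrongDual φ
  -- Since `toDual` is conjugate-linear, conjugating restores linearity, and Riesz applies a second
  -- time.
  let g : StrongDual ℂ H := LinearMap.mkContinuous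
    { toFun := fun y => star (ψ (InnerProductSpace.toDual ℂ H y))
      map_add' := fun x y => by simp
      map_smul' := fun c x => by simp [map_smulₛₗ] } ‖ψ‖ fun y => by
        simpa using ψ.le_opNorm (InnerProductSpace.toDual ℂ H y)
  refine ⟨(InnerProductSpace.toDual ℂ H).symm g, ?_⟩
  refine DFunLike.ext _ _ fun l => ?_
  obtain ⟨y, rfl⟩ := (InnerProductSpace.toDual ℂ H).surjective l
  change inner ℂ y ((InnerProductSpace.toDual ℂ H).symm g) = ψ (InnerProductSpace.toDual ℂ H y)
  rw [← inner_conj_symm, InnerProductSpace.toDual_symm_apply]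
  exact star_star _

theorem isCompact_closure_image_toWeakSpace {A : Set H} (hA : Bornology.IsBounded A) :
    IsCompact (closure (toWeakSpace ℂ H '' A)) := by
  refine NormedSpace.isCompact_closure_of_isBounded ℂ H _ ?_
    (by rw [surjective_inclusionInDoubleDualWeak.range_eq]; exact subset_univ _)
  rwa [(toWeakSpace ℂ H).injective.preimage_image]

end WeakCompactness

theorem exists_mem_forall_norm_sub_le_imp_eq {H : Type*} [NormedAddCommGroup H] [InnerProductSpace ℝ H]
    [CompleteSpace H] {C : Set H} (hne : C.Nonempty) (hC : IsClosed C) (hconv : Convex ℝ C)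
    (a : H) : ∃ p ∈ C, ∀ w ∈ C, ‖a - w‖ ≤ ‖a - p‖ → w = p := by
  obtain ⟨p, hp, hmin⟩ := exists_norm_eq_iInf_of_complete_convex hne hC.isComplete hconv a
  refine ⟨p, hp, fun w hw hle => ?_⟩
  have h := (norm_eq_iInf_iff_real_inner_le_zero hconv hp).1 hmin w hw
  have hsq : ‖a - w‖ ^ 2 ≤ ‖a - p‖ ^ 2 := by gcongr
  rw [← sub_sub_sub_cancel_right a w p, norm_sub_sq_real] at hsq
  have : ‖w - p‖ ^ 2 ≤ 0 := by linarith
  exact sub_eq_zero.1 (norm_eq_zero.1 (pow_eq_zero_iff two_ne_zero |>.1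
    (this.antisymm (sq_nonneg _))))

/-! ### The weak topology on `C` -/

section WeakTopologyOn

variable {H : Type*} [NormedAddCommGroup H] [InnerProductSpace ℂ H] {C : Set H}

theorem t2Space_weakTopologyOn : @T2Space C (weakTopologyOn C) := by
  let : TopologicalSpace C := weakTopologyOn C
  exact T2Space.of_injective_continuous
    ((toWeakSpace ℂ H).injective.comp Subtype.val_injective) continuous_induced_dom

theorem continuous_inner_weakTopologyOn (h : H) :
    @Continuous C ℝ (weakTopologyOn C) _
      fun x => @inner ℝ H InnerProductSpace.complexToReal.toInner h x := by
  let : TopologicalSpace C := weakTopologyOn C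
  have h1 : Continuous fun x : WeakSpace ℂ H => innerSL ℂ h ((toWeakSpace ℂ H).symm x) :=
    WeakBilin.eval_continuous (topDualPairing ℂ H).flip (innerSL ℂ h)
  have h2 : Continuous fun x : C => toWeakSpace ℂ H (x : H) := continuous_induced_dom
  exact Complex.continuous_re.comp (h1.comp h2)

theorem isCompact_weakTopologyOn_closure [CompleteSpace H] (hC : IsWeaklyClosed C) {A : Set C}
    (hA : Bornology.IsBounded (Subtype.val '' A)) :
    @IsCompact C (weakTopologyOn C) (@closure C (weakTopologyOn C) A) := by
  let : TopologicalSpace C := weakTopologyOn C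
  have hemb : IsClosedEmbedding fun x : C => toWeakSpace ℂ H (x : H) := by
    refine ⟨⟨⟨rfl⟩, (toWeakSpace ℂ H).injective.comp Subtype.val_injective⟩, ?_⟩
    change IsClosed (range (toWeakSpace ℂ H ∘ Subtype.val))
    rwa [range_comp, Subtype.range_coe]
  rw [hemb.isCompact_iff, ← hemb.closure_image_eq]
  simpa [image_image] using isCompact_closure_image_toWeakSpace hA

theorem isBounded_weakTopologyOn_closure {A : Set C}
    (hA : Bornology.IsBounded (Subtype.val '' A)) :
    Bornology.IsBounded (Subtype.val '' @closure C (weakTopologyOn C) A) := by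
  let : TopologicalSpace C := weakTopologyOn C
  obtain ⟨R, hR⟩ := hA.exists_norm_le
  refine isBounded_iff_forall_norm_le.2 ⟨R, ?_⟩
  rintro _ ⟨x, hx, rfl⟩
  let : InnerProductSpace ℝ H := InnerProductSpace.complexToReal
  have hcl : IsClosed {y : C | inner ℝ (x : H) (y : H) ≤ ‖(x : H)‖ * R} :=
    isClosed_le (continuous_inner_weakTopologyOn _) continuous_const
  have hx' : inner ℝ (x : H) (x : H) ≤ ‖(x : H)‖ * R :=
    closure_minimal (fun y hy => (real_inner_le_norm _ _).trans
      (mul_le_mul_of_nonneg_left (hR _ ⟨y, hy, rfl⟩) (norm_nonneg _))) hcl hx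
  rw [real_inner_self_eq_norm_mul_norm] at hx'
  rcases (norm_nonneg (x : H)).eq_or_lt with h0 | h0
  · obtain ⟨y, hy⟩ := closure_nonempty_iff.1 ⟨x, hx⟩
    rw [← h0]
    exact (norm_nonneg _).trans (hR _ ⟨y, hy, rfl⟩)
  · exact le_of_mul_le_mul_left hx' h0

theorem IsWeaklyClosed.isClosed (hC : IsWeaklyClosed C) : IsClosed C := by
  have h := hC.preimage (toWeakSpaceCLM ℂ H).continuous
  change IsClosed (toWeakSpace ℂ H ⁻¹' (toWeakSpace ℂ H '' C)) at h
  rwa [(toWeakSpace ℂ H).injective.preimage_image] at h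

end WeakTopologyOn

/-! ### Attractive points and common fixed points -/

theorem nonempty_attractivePoints {S : Type*} [Semigroup S] [TopologicalSpace S]
    {H : Type*} [NormedAddCommGroup H] [InnerProductSpace ℂ H] [CompleteSpace H]
    (hS : LeftReversible S) {C : Set H} (hC : IsWeaklyClosed C)
    {T : S → C → C} (hrep : IsRepresentation T) (hne : IsNonexpansiveRep T)
    (hcont : IsWeaklyJointlyContinuous T)
    (hbdd : ∃ c : C, Bornology.IsBounded (range fun s : S => (T s c : H))) :
    (attractivePoints T).Nonempty := by
  rcases isEmpty_or_nonempty S with hSe | hSne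
  · exact ⟨0, fun s => hSe.elim s⟩
  obtain ⟨c, hc⟩ := hbdd
  let : InnerProductSpace ℝ H := InnerProductSpace.complexToReal
  let : TopologicalSpace C := weakTopologyOn C
  have : T2Space C := t2Space_weakTopologyOn
  have hcont' : Continuous fun p : S × C => T p.1 p.2 := hcont
  have hT : ∀ s, Continuous (T s) := fun s => hcont'.comp (Continuous.prodMk_right s)
  have hT' : ∀ x, Continuous fun s => T s x := fun x => hcont'.comp (Continuous.prodMk_left x)
  have horb : Bornology.IsBounded (Subtype.val '' range fun s => T s c) := by
    rwa [← range_comp]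
  have hmaps : ∀ s, MapsTo (T s) (closure (range fun s => T s c))
      (closure (range fun s => T s c)) :=
    fun s => MapsTo.closure (by rintro _ ⟨t, rfl⟩; exact ⟨s * t, hrep s t c⟩) (hT s)
  obtain ⟨F, hFK, hFne, hF, hFT⟩ := hS.exists_isCompact_subset_image hrep hT hT'
    (isCompact_weakTopologyOn_closure hC horb) (range_nonempty _).closure hmaps
  obtain ⟨Q, hQF, hQ⟩ := exists_minimal_isCompact_subset_image hT hFne hF hFT
  have htb : TotallyBounded ((Subtype.val : C → H) '' Q) :=
    totallyBounded_image_of_minimal (E := (Subtype.val : C → H)) continuous_inner_weakTopologyOn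
      hT hne hQ ((isBounded_weakTopologyOn_closure horb).subset (image_mono (hQF.trans hFK)))
  obtain ⟨a, ha⟩ := exists_attractive hQ.prop.1 htb
  exact ⟨a, fun s x => ha (T s) (hQ.prop.2.2 s) (hne s) x⟩

theorem mainTheorem3
    {S : Type*} [Semigroup S] [TopologicalSpace S] [T2Space S] [SeparatelyContinuousMul S]
    [TopologicalSpace.SeparableSpace S]
    {H : Type*} [NormedAddCommGroup H] [InnerProductSpace ℂ H] [CompleteSpace H]
    (hS : LeftReversible S)
    (C : Set H) (hC : IsWeaklyClosed C)
    (T : S → C → C) (hrep : IsRepresentation T) (hne : IsNonexpansiveRep T)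
    (hcont : IsWeaklyJointlyContinuous T)
    (hbdd : ∃ c : C, Bornology.IsBounded (range fun s : S => (T s c : H))) :
    (attractivePoints T).Nonempty ∧ (Convex ℝ C → (commonFixedPoints T).Nonempty) := by
  obtain ⟨a, ha⟩ := nonempty_attractivePoints hS hC hrep hne hcont hbdd
  refine ⟨⟨a, ha⟩, fun hconv => ?_⟩
  obtain ⟨c, -⟩ := hbdd
  let : InnerProductSpace ℝ H := InnerProductSpace.complexToReal
  obtain ⟨p, hp, hfix⟩ :=
    exists_mem_forall_norm_sub_le_imp_eq (C := C) ⟨c, c.2⟩ hC.isClosed hconv a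
  -- `T s p` lies in `C` and is no farther from `a` than the nearest point `p`, so it equals `p`.
  exact ⟨⟨p, hp⟩, fun s => Subtype.ext (hfix _ (T s ⟨p, hp⟩).2 (ha s ⟨p, hp⟩))⟩
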